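/- The function $h(l)=9l+\ln(1-2l)-\ln l-3$ has exactly one root $l$ in $(0,\tfrac14)$, and $|l-0.0945|<0.00005$. Put $r=1-2l$, $\alpha=r/l$, and $$M_x=\{(t,1-2t,1-2t):0\le t\le l\},\quad M_y=\{(1-2t,t,1-2t):0\le t\le l\},\quad M_z=\{(1-2t,1-2t,t):0\le t\le l\},$$ $$M_2=\{(x,y,z): l\le x,y,z\le r,\ xyz=lr^2\},\qquad M=M_x\cup M_y\cup M_z\cup M_2 .$$ Then there exists a probability measure $\mu$ on $[0,1]^3$ whose three one-dimensional marginals are the Lebesgue measure on $[0,1]$ and which is concentrated on $M$, i.e. $\mu(M^c)=0$. Explicitly, one may take $$\mu=\mu_{\mathrm{lin}}+l\ln\alpha\cdot\Phi_*(\mu_p+\mu_q),$$ where: * $\mu_{\mathrm{lin}}$ is the sum of the uniform measures of total mass $l$ on the three segments $M_x,M_y,M_z$; * $\Phi(u,v,w)=(l\alpha^u,l\alpha^v,l\alpha^w)$ (the inverse of $u=\frac{\ln x-\ln l}{\ln r-\ln l}$ in each coordinate), which maps the triangle $\Delta=\{u+v+w=2,\ 0\le u,v,w\le1\}$ onto $M_2$;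 * $\mu_p$ is the layered measure on $\Delta$ with density $p(\min(1-u,1-v,1-w))$ with respect to the Lebesgue measure on $\Delta$ normalized to total mass $\tfrac12$, where for $0\le x<\tfrac13$ $$p(x)=\frac{\alpha^{1-x}-4\alpha^{2x}}{1-3x}-6\,\frac{2\alpha^{2x}+\alpha^{1-x}}{(1-3x)^2\ln\alpha}-18\,\frac{\alpha^{2x}-\alpha^{1-x}}{(1-3x)^3\ln^2\alpha};$$ * $\mu_q$ is the median measure on $\Delta$: the sum of the images of the measure $q(t)\,dt$ on $[0,\tfrac23]$ under the maps $t\mapsto(1-\tfrac t2,1-\tfrac t2,t)$, $t\mapsto(1-\tfrac t2,t,1-\tfrac t2)$, $t\mapsto(t,1-\tfrac t2,1-\tfrac t2)$, where for $0\le x<\tfrac13$ $$q(2x)=\alpha^{2x}+2\,\frac{2\alpha^{2x}+\alpha^{1-x}}{(1-3x)\ln\alpha}+6\,\frac{\alpha^{2x}-\alpha^{1-x}}{(1-3x)^2\ln^2\alpha}.$$ The functions $p$ on $[0,\tfrac13)$ and $q$ on $[0,\tfrac23)$ are nonnegative. -/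

import Mathlib

open MeasureTheory Set

noncomputable section

/-- The conditions on the parameter `l`: it lies in `(0, 1/4)` and is a root of
`9 l + ln (1 - 2 l) - ln l - 3`. -/
def IsParameter (l : ℝ) : Prop :=
  l ∈ Ioo (0 : ℝ) (1 / 4) ∧ 9 * l + Real.log (1 - 2 * l) - Real.log l - 3 = 0

/-- The segment `M_x`. -/
def segX (l : ℝ) : Set (ℝ × ℝ × ℝ) := {P | ∃ t ∈ Icc 0 l, P = (t, 1 - 2 * t, 1 - 2 * t)}

/-- The segment `M_y`. -/
def segY (l : ℝ) : Set (ℝ × ℝ × ℝ) := {P | ∃ t ∈ Icc 0 l, P = (1 - 2 * t, t, 1 - 2 * t)}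

/-- The segment `M_z`. -/
def segZ (l : ℝ) : Set (ℝ × ℝ × ℝ) := {P | ∃ t ∈ Icc 0 l, P = (1 - 2 * t, 1 - 2 * t, t)}

/-- The surface `M_2`: the points of the cube `[l, r]³` with `x y z = l r²`, where `r = 1 - 2 l`. -/
def surf (l : ℝ) : Set (ℝ × ℝ × ℝ) :=
  {P | P.1 ∈ Icc l (1 - 2 * l) ∧ P.2.1 ∈ Icc l (1 - 2 * l) ∧ P.2.2 ∈ Icc l (1 - 2 * l) ∧
    P.1 * P.2.1 * P.2.2 = l * (1 - 2 * l) ^ 2}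

/-- The set `M`. -/
def setM (l : ℝ) : Set (ℝ × ℝ × ℝ) := segX l ∪ segY l ∪ segZ l ∪ surf l

/-- `μ` is a probability measure on the cube `[0, 1]³` whose three one-dimensional marginals are
the Lebesgue measure on `[0, 1]`. -/
def IsThreeOneStochastic (μ : Measure (ℝ × ℝ × ℝ)) : Prop :=
  IsProbabilityMeasure μ ∧ μ (Icc (0, 0, 0) (1, 1, 1))ᶜ = 0 ∧
    μ.map (fun P => P.1) = volume.restrict (Icc 0 1) ∧
    μ.map (fun P => P.2.1) = volume.restrict (Icc 0 1) ∧
    μ.map (fun P => P.2.2) = volume.restrict (Icc 0 1)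

/-- The sum of the uniform measures of total mass `l` on the three segments: each of them is the
image of the Lebesgue measure on `[0, l]` under the affine parametrization of the segment. -/
def segmentMeasure (l : ℝ) : Measure (ℝ × ℝ × ℝ) :=
  (volume.restrict (Icc 0 l)).map (fun t : ℝ => (t, 1 - 2 * t, 1 - 2 * t)) +
  (volume.restrict (Icc 0 l)).map (fun t : ℝ => (1 - 2 * t, t, 1 - 2 * t)) +
  (volume.restrict (Icc 0 l)).map (fun t : ℝ => (1 - 2 * t, 1 - 2 * t, t))

/-- The Lebesgue measure on the triangle `Δ = {u + v + w = 2, 0 ≤ u, v, w ≤ 1}`, normalized to have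
total mass `1/2`: its projection to the first two coordinates is the planar Lebesgue measure on
the triangle with vertices `(0, 1)`, `(1, 0)`, `(1, 1)`. -/
def triangleMeasure : Measure (ℝ × ℝ × ℝ) :=
  ((volume : Measure (ℝ × ℝ)).restrict {s | s.1 ≤ 1 ∧ s.2 ≤ 1 ∧ 1 ≤ s.1 + s.2}).map
    (fun s => (s.1, s.2, 2 - s.1 - s.2))

/-- The layered measure generated by `p`: its density with respect to the normalized Lebesgue
measure on `Δ` is `p (min (1 - u) (1 - v) (1 - w))`. -/
def layeredMeasure (p : ℝ → ℝ) : Measure (ℝ × ℝ × ℝ) :=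
  triangleMeasure.withDensity
    (fun P => ENNReal.ofReal (p (min (1 - P.1) (min (1 - P.2.1) (1 - P.2.2)))))

/-- The median measure generated by `q`: on each of the three segments that join a vertex of `Δ` to
its center, the image of the measure `q(t) dt` on `[0, 2/3]` under the affine parametrization of
the segment by its smallest coordinate `t`. -/
def medianMeasure (q : ℝ → ℝ) : Measure (ℝ × ℝ × ℝ) :=
  let m := (volume.restrict (Icc (0 : ℝ) (2 / 3))).withDensity (fun t => ENNReal.ofReal (q t))
  m.map (fun t => (1 - t / 2, 1 - t / 2, t)) +
  m.map (fun t => (1 - t / 2, t, 1 - t / 2)) +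
  m.map (fun t => (t, 1 - t / 2, 1 - t / 2))

/-- The generating function of the layered measure, on `[0, 1/3)`. -/
def layerGen (α x : ℝ) : ℝ :=
  (α ^ (1 - x) - 4 * α ^ (2 * x)) / (1 - 3 * x)
    - 6 * ((2 * α ^ (2 * x) + α ^ (1 - x)) / ((1 - 3 * x) ^ 2 * Real.log α))
    - 18 * ((α ^ (2 * x) - α ^ (1 - x)) / ((1 - 3 * x) ^ 3 * Real.log α ^ 2))

/-- The function `x ↦ q(2 x)` on `[0, 1/3)`, where `q` generates the median measure. -/
def medianGenTwice (α x : ℝ) : ℝ :=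
  α ^ (2 * x) + 2 * ((2 * α ^ (2 * x) + α ^ (1 - x)) / ((1 - 3 * x) * Real.log α))
    + 6 * ((α ^ (2 * x) - α ^ (1 - x)) / ((1 - 3 * x) ^ 2 * Real.log α ^ 2))

/-- The generating function `q` of the median measure, on `[0, 2/3)`. -/
def medianGen (α t : ℝ) : ℝ := medianGenTwice α (t / 2)

/-- The inverse of the change of variables `u = (ln x - ln l) / (ln r - ln l)` in each coordinate:
`x = l α ^ u` with `α = r / l`. -/
def expMap (l α : ℝ) (P : ℝ × ℝ × ℝ) : ℝ × ℝ × ℝ := (l * α ^ P.1, l * α ^ P.2.1, l * α ^ P.2.2)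

/-- The explicit measure: with `α = r / l = (1 - 2 l) / l`, the uniform measures on the three
segments plus `l ln α` times the image on the surface of the sum of the layered and the median
measure on `Δ`. -/
def explicitMeasure (l : ℝ) : Measure (ℝ × ℝ × ℝ) :=
  let α := (1 - 2 * l) / l
  segmentMeasure l + ENNReal.ofReal (l * Real.log α) •
    (layeredMeasure (layerGen α) + medianMeasure (medianGen α)).map (expMap l α)

end

open MeasureTheory Set

noncomputable section

/-! Each coordinate sees the three segments as Lebesgue measure on `[0, l] ∪ [r, 1]`: one segment
covers `[0, l]` with density 1, and the other two cover `[r, 1]` with density 1/2 each. The surface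
part must therefore project to Lebesgue measure on `[l, r]`. Under `x = l α ^ u` this is `l ln α · α
^ u du` on `[0, 1]`, so the layered and median measures on the triangle must together have marginal
density `α ^ u`.

Let `P` be the primitive of `p` with `P 0 = 0`. At height `u`, with `m = min (1 - u) (u / 2)`, the
layered measure contributes `2 P(m) + (u - 2m) p(m)`. The median measure contributes `q(u)` for `u <
2/3` and `4 q(2(1 - u))` for `u > 2/3`. Writing `u = 2x`, respectively `u = 1 - x`, the requirement
becomes `2 P(x) + q(2x) = α ^ (2x)` and `2 P(x) + (1 - 3x) p(x) + 4 q(2x) = α ^ (1 - x)`. The given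
`p`, `q` satisfy both once `P` is defined by the first equation (`hasDerivAt_layerPrimitive`,
`layerGen_relation`). The remaining condition `P 0 = 0` is `ln α · (2 + α) = 3 (α - 1)`, which for
`α = (1 - 2l) / l` is exactly the equation defining `l`.

Nonnegativity reduces to two exponential inequalities in `w = (1 - 3x) ln α`. The support claim
holds because `u + v + w = 2` gives `xyz = l³ α² = l r²`. -/

/-! ### Nonnegativity of the generating functions. -/

theorem nonneg_of_deriv_nonneg {f f' : ℝ → ℝ} (hf : ∀ x, HasDerivAt f (f' x) x)
    (h0 : f 0 = 0) (hf' : ∀ x, 0 ≤ x → 0 ≤ f' x) {x : ℝ} (hx : 0 ≤ x) : 0 ≤ f x := by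
  have hm : MonotoneOn f (Ici 0) := by
    refine monotoneOn_of_deriv_nonneg (convex_Ici 0)
      (fun x _ => (hf x).continuousAt.continuousWithinAt)
      (fun x _ => (hf x).differentiableAt.differentiableWithinAt) fun x hx => ?_
    rw [interior_Ici] at hx
    rw [(hf x).deriv]
    exact hf' x (le_of_lt hx)
  simpa [h0] using hm self_mem_Ici hx hx

/-- Multiplied by `exp (-w)`, the expression vanishes at 0 and has derivative `2 - exp (-w) (w ^ 2 +
2 w + 2)`, which is nonnegative because `1 + w + w ^ 2 / 2 ≤ exp w`. -/
theorem median_exp_bound {w : ℝ} (hw : 0 ≤ w) :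
    0 ≤ w ^ 2 + 4 * w + 6 + (2 * w - 6) * Real.exp w := by
  have key : 0 ≤ Real.exp (-w) * (w ^ 2 + 4 * w + 6) + (2 * w - 6) := by
    refine nonneg_of_deriv_nonneg
      (f := fun w => Real.exp (-w) * (w ^ 2 + 4 * w + 6) + (2 * w - 6))
      (f' := fun w => 2 - Real.exp (-w) * (w ^ 2 + 2 * w + 2)) (fun x => ?_) (by norm_num)
      (fun x hx => ?_) hw
    · have h1 : HasDerivAt (fun w : ℝ => Real.exp (-w)) (Real.exp (-x) * (-1)) x :=
        (hasDerivAt_neg x).exp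
      have h2 : HasDerivAt (fun w : ℝ => w ^ 2 + 4 * w + 6) (2 * x + 4) x := by
        simpa using (((hasDerivAt_id x).pow 2).add ((hasDerivAt_id x).const_mul 4)).add_const 6
      have h3 : HasDerivAt (fun w : ℝ => 2 * w - 6) 2 x := by
        simpa using ((hasDerivAt_id x).const_mul 2).sub_const 6
      refine ((h1.mul h2).add h3).congr_deriv ?_
      ring
    · have h := Real.quadratic_le_exp_of_nonneg hx
      have h1 : Real.exp (-x) * Real.exp x = 1 := by rw [← Real.exp_add]; simp
      nlinarith [mul_le_mul_of_nonneg_left h (Real.exp_pos (-x)).le]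
  have h1 : Real.exp (-w) * Real.exp w = 1 := by rw [← Real.exp_add]; simp
  have h2 := mul_nonneg key (Real.exp_pos w).le
  linear_combination h2 + (w ^ 2 + 4 * w + 6) * h1

/-- Multiplied by `exp (-w)`, the expression vanishes at 0; its derivative is `exp (-w)` times the
sum of the expression in `median_exp_bound` and `3 w ^ 2`. -/
theorem layer_exp_bound {w : ℝ} (hw : 0 ≤ w) :
    0 ≤ Real.exp w * (w ^ 2 - 6 * w + 18) - 4 * w ^ 2 - 12 * w - 18 := by
  have key : 0 ≤ w ^ 2 - 6 * w + 18 - Real.exp (-w) * (4 * w ^ 2 + 12 * w + 18) := by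
    refine nonneg_of_deriv_nonneg
      (f := fun w => w ^ 2 - 6 * w + 18 - Real.exp (-w) * (4 * w ^ 2 + 12 * w + 18))
      (f' := fun w => 2 * w - 6 + Real.exp (-w) * (4 * w ^ 2 + 4 * w + 6)) (fun x => ?_)
      (by norm_num) (fun x hx => ?_) hw
    · have h1 : HasDerivAt (fun w : ℝ => Real.exp (-w)) (Real.exp (-x) * (-1)) x :=
        (hasDerivAt_neg x).exp
      have h2 : HasDerivAt (fun w : ℝ => 4 * w ^ 2 + 12 * w + 18) (4 * (2 * x) + 12) x := by
        simpa using ((((hasDerivAt_id x).pow 2).const_mul 4).add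
          ((hasDerivAt_id x).const_mul 12)).add_const 18
      have h3 : HasDerivAt (fun w : ℝ => w ^ 2 - 6 * w + 18) (2 * x - 6) x := by
        simpa using (((hasDerivAt_id x).pow 2).sub ((hasDerivAt_id x).const_mul 6)).add_const 18
      refine (h3.sub (h1.mul h2)).congr_deriv ?_
      ring
    · have h1 : Real.exp (-x) * Real.exp x = 1 := by rw [← Real.exp_add]; simp
      have h2 := mul_nonneg (Real.exp_pos (-x)).le (median_exp_bound hx)
      have h3 : 0 ≤ Real.exp (-x) * (3 * x ^ 2) := by positivity
      linear_combination h2 + h3 + (2 * x - 6) * h1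
  have h1 : Real.exp (-w) * Real.exp w = 1 := by rw [← Real.exp_add]; simp
  have h2 := mul_nonneg key (Real.exp_pos w).le
  linear_combination h2 - (4 * w ^ 2 + 12 * w + 18) * h1

theorem rpow_one_sub_eq {α : ℝ} (hα : 1 < α) (x : ℝ) :
    α ^ (1 - x) = α ^ (2 * x) * Real.exp (Real.log α * (1 - 3 * x)) := by
  rw [← Real.rpow_def_of_pos (by linarith), ← Real.rpow_add (by linarith)]
  congr 1
  ring

theorem layerGen_nonneg {α x : ℝ} (hα : 1 < α) (hx : x < 1 / 3) : 0 ≤ layerGen α x := by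
  have ha := Real.log_pos hα
  have hy : 0 < 1 - 3 * x := by linarith
  have h := layer_exp_bound (mul_pos ha hy).le
  have hA : 0 < α ^ (2 * x) := Real.rpow_pos_of_pos (by linarith) _
  have : layerGen α x = α ^ (2 * x) / ((1 - 3 * x) ^ 3 * Real.log α ^ 2) *
      (Real.exp (Real.log α * (1 - 3 * x)) * ((Real.log α * (1 - 3 * x)) ^ 2
        - 6 * (Real.log α * (1 - 3 * x)) + 18) - 4 * (Real.log α * (1 - 3 * x)) ^ 2
        - 12 * (Real.log α * (1 - 3 * x)) - 18) := by
    rw [layerGen, rpow_one_sub_eq hα]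
    field_simp
    ring
  rw [this]
  positivity

theorem medianGenTwice_nonneg {α x : ℝ} (hα : 1 < α) (hx : x < 1 / 3) :
    0 ≤ medianGenTwice α x := by
  have ha := Real.log_pos hα
  have hy : 0 < 1 - 3 * x := by linarith
  have h := median_exp_bound (mul_pos ha hy).le
  have hA : 0 < α ^ (2 * x) := Real.rpow_pos_of_pos (by linarith) _
  have : medianGenTwice α x = α ^ (2 * x) / ((1 - 3 * x) ^ 2 * Real.log α ^ 2) *
      ((Real.log α * (1 - 3 * x)) ^ 2 + 4 * (Real.log α * (1 - 3 * x)) + 6 +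
        (2 * (Real.log α * (1 - 3 * x)) - 6) * Real.exp (Real.log α * (1 - 3 * x))) := by
    rw [medianGenTwice, rpow_one_sub_eq hα]
    generalize 1 - 3 * x = y at *
    field_simp
    ring
  rw [this]
  positivity

/-! ### The marginal equations and the condition at zero. -/

/-- The primitive of `layerGen α` which vanishes at `0` for the right parameter. -/
def layerPrimitive (α x : ℝ) : ℝ := (α ^ (2 * x) - medianGenTwice α x) / 2

theorem hasDerivAt_layerPrimitive {α x : ℝ} (hα : 1 < α) (hx : x < 1 / 3) :
    HasDerivAt (layerPrimitive α) (layerGen α x) x := by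
  have ha := Real.log_pos hα
  have hy : 1 - 3 * x ≠ 0 := by linarith
  have h0 : 0 < α := by linarith
  have hA : HasDerivAt (fun x : ℝ => α ^ (2 * x)) (Real.log α * 2 * α ^ (2 * x)) x := by
    simpa using ((hasDerivAt_id x).const_mul 2).const_rpow h0
  have hB : HasDerivAt (fun x : ℝ => α ^ (1 - x)) (Real.log α * (-1) * α ^ (1 - x)) x := by
    simpa using ((hasDerivAt_id x).const_sub 1).const_rpow h0
  have hY : HasDerivAt (fun x : ℝ => 1 - 3 * x) (-3) x := by
    simpa using ((hasDerivAt_id x).const_mul 3).const_sub 1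
  have hy2 : (1 - 3 * x) ^ 2 * Real.log α ^ 2 ≠ 0 := by positivity
  have h1 := (((hA.const_mul 2).add hB).div (hY.mul_const (Real.log α)) (by positivity)).const_mul 2
  have h2 := ((hA.sub hB).div ((hY.pow 2).mul_const (Real.log α ^ 2)) hy2).const_mul 6
  have h3 := (hA.sub ((hA.add h1).add h2)).div_const 2
  refine h3.congr_deriv ?_
  simp only [layerGen, Pi.add_apply, Pi.sub_apply, Pi.pow_apply]
  generalize α ^ (2 * x) = A, α ^ (1 - x) = B, 1 - 3 * x = y at *
  push_cast
  field_simp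
  ring

/-- The marginal equation for heights `u = 1 - x > 2/3`; the one for `u = 2x < 2/3` is built into
the definition of `layerPrimitive`. -/
theorem layerGen_relation {α x : ℝ} (hα : 1 < α) (hx : x < 1 / 3) :
    2 * layerPrimitive α x + (1 - 3 * x) * layerGen α x + 4 * medianGenTwice α x
      = α ^ (1 - x) := by
  have ha := Real.log_pos hα
  have hy : 1 - 3 * x ≠ 0 := by linarith
  simp only [layerGen, layerPrimitive, medianGenTwice]
  generalize α ^ (2 * x) = A, α ^ (1 - x) = B, 1 - 3 * x = y at *
  field_simp
  ring

/-- The formulas leave no free constant of integration, so the vanishing at 0 is a condition on `α`,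
and this is what selects `l`. -/
theorem layerPrimitive_zero {α : ℝ} (hα : 1 < α) (h : Real.log α * (2 + α) = 3 * (α - 1)) :
    layerPrimitive α 0 = 0 := by
  have ha := Real.log_pos hα
  simp only [layerPrimitive, medianGenTwice]
  norm_num
  field_simp
  linear_combination -2 * h

theorem log_ratio_of_isParameter {l : ℝ} (hl : IsParameter l) :
    1 < (1 - 2 * l) / l ∧ Real.log ((1 - 2 * l) / l) * (2 + (1 - 2 * l) / l)
      = 3 * ((1 - 2 * l) / l - 1) := by
  obtain ⟨⟨h0, h1⟩, h⟩ := hl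
  refine ⟨by rw [lt_div_iff₀ h0]; linarith, ?_⟩
  rw [Real.log_div (by linarith) h0.ne']
  field_simp
  linear_combination h

/-! ### Existence, uniqueness and location of the parameter. -/

/-- The function whose root in `(0, 1/4)` is the parameter. -/
def parameterFun (l : ℝ) : ℝ := 9 * l + Real.log (1 - 2 * l) - Real.log l - 3

theorem hasDerivAt_parameterFun {l : ℝ} (h0 : 0 < l) (h1 : l < 1 / 2) :
    HasDerivAt parameterFun (-((6 * l - 1) * (3 * l - 1) / (l * (1 - 2 * l)))) l := by
  have hr : 1 - 2 * l ≠ 0 := by linarith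
  have h2 : HasDerivAt (fun l : ℝ => 1 - 2 * l) (-2) l := by
    simpa using ((hasDerivAt_id l).const_mul 2).const_sub 1
  have h3 : HasDerivAt (fun l : ℝ => 9 * l) 9 l := by
    simpa using (hasDerivAt_id l).const_mul 9
  refine (((h3.add (h2.log hr)).sub (Real.hasDerivAt_log h0.ne')).sub_const 3).congr_deriv ?_
  have hr' : l * (1 - 2 * l) ≠ 0 := mul_ne_zero h0.ne' hr
  rw [eq_neg_iff_add_eq_zero]
  field_simp
  ring

theorem strictAntiOn_parameterFun : StrictAntiOn parameterFun (Ioc 0 (1 / 6)) := by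
  refine strictAntiOn_of_deriv_neg (convex_Ioc _ _) (fun x hx =>
    (hasDerivAt_parameterFun hx.1 (by linarith [hx.2])).continuousAt.continuousWithinAt)
    fun x hx => ?_
  rw [interior_Ioc] at hx
  rw [(hasDerivAt_parameterFun hx.1 (by linarith [hx.2])).deriv, neg_lt_zero]
  exact div_pos (mul_pos_of_neg_of_neg (by linarith [hx.2]) (by linarith [hx.2]))
    (mul_pos hx.1 (by linarith [hx.2]))

/-- With the negative value at `1/4`, this excludes roots in `[1/6, 1/4)`. -/
theorem monotoneOn_parameterFun : MonotoneOn parameterFun (Icc (1 / 6) (1 / 4)) := by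
  refine monotoneOn_of_deriv_nonneg (convex_Icc _ _) (fun x hx =>
    (hasDerivAt_parameterFun (by linarith [hx.1])
      (by linarith [hx.2])).continuousAt.continuousWithinAt) (fun x hx => ?_) fun x hx => ?_
  all_goals rw [interior_Icc] at hx
  · exact (hasDerivAt_parameterFun (by linarith [hx.1])
      (by linarith [hx.2])).differentiableAt.differentiableWithinAt
  · rw [(hasDerivAt_parameterFun (by linarith [hx.1]) (by linarith [hx.2])).deriv, neg_nonneg]
    exact div_nonpos_of_nonpos_of_nonneg
      (mul_nonpos_of_nonneg_of_nonpos (by linarith [hx.1]) (by linarith [hx.2]))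
      (mul_nonneg (by linarith [hx.1]) (by linarith [hx.2]))

theorem parameterFun_quarter_neg : parameterFun (1 / 4) < 0 := by
  have h : Real.log (1 / 4) = -(2 * Real.log 2) := by
    rw [one_div, Real.log_inv, show (4 : ℝ) = 2 ^ 2 by norm_num, Real.log_pow]
    norm_num
  have h' : Real.log (1 - 2 * (1 / 4)) = -Real.log 2 := by
    rw [← Real.log_inv]
    norm_num
  rw [parameterFun, h, h']
  linarith [Real.log_two_lt_d9]

theorem parameterFun_lower_pos : 0 < parameterFun 0.09445 := by
  -- The ratio `r / l` is close to `8.59`; splitting off `8 = 2 ^ 3` leaves the logarithm of a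
  -- number near 1, where elementary bounds are sharp enough.
  have h : Real.log (1 - 2 * 0.09445) - Real.log 0.09445
      = 3 * Real.log 2 + Real.log (1 + 555 / 7556) := by
    rw [← Real.log_div (by norm_num) (by norm_num), show (3 : ℝ) = (3 : ℕ) by norm_num,
      ← Real.log_pow, ← Real.log_mul (by norm_num) (by norm_num)]
    norm_num
  have h1 := Real.le_log_one_add_of_nonneg (x := 555 / 7556) (by norm_num)
  norm_num at h1
  rw [parameterFun]
  linarith [Real.log_two_gt_d9]

theorem parameterFun_upper_neg : parameterFun 0.09455 < 0 := by
  have h : Real.log (1 - 2 * 0.09455) - Real.log 0.09455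
      = 3 * Real.log 2 + Real.log (8109 / 7564) := by
    rw [← Real.log_div (by norm_num) (by norm_num), show (3 : ℝ) = (3 : ℕ) by norm_num,
      ← Real.log_pow, ← Real.log_mul (by norm_num) (by norm_num)]
    norm_num
  have h1 : Real.log (8109 / 7564) < 0.0696 := by
    rw [Real.log_lt_iff_lt_exp (by norm_num)]
    refine lt_of_lt_of_le ?_ (Real.sum_le_exp_of_nonneg (by norm_num) 4)
    norm_num [Finset.sum_range_succ, Nat.factorial]
  rw [parameterFun]
  linarith [Real.log_two_lt_d9]

theorem IsParameter.mem_Ioo {l : ℝ} (hl : IsParameter l) : l ∈ Ioo (0.09445 : ℝ) 0.09455 := by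
  obtain ⟨⟨h0, h1⟩, h⟩ := hl
  change parameterFun l = 0 at h
  have h6 : l < 1 / 6 := by
    by_contra! h6
    have := monotoneOn_parameterFun ⟨h6, h1.le⟩ ⟨by norm_num, le_rfl⟩ h1.le
    linarith [parameterFun_quarter_neg]
  refine ⟨(strictAntiOn_parameterFun.lt_iff_gt (b := 0.09445) ⟨h0, h6.le⟩ (by norm_num)).1 ?_,
    (strictAntiOn_parameterFun.lt_iff_gt (a := 0.09455) (by norm_num) ⟨h0, h6.le⟩).1 ?_⟩
  · rw [h]
    exact parameterFun_lower_pos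
  · rw [h]
    exact parameterFun_upper_neg

theorem existsUnique_isParameter : ∃! l : ℝ, IsParameter l := by
  have hc : ContinuousOn parameterFun (Icc 0.09445 0.09455) := fun x hx =>
    (hasDerivAt_parameterFun (by linarith [hx.1])
      (by linarith [hx.2])).continuousAt.continuousWithinAt
  obtain ⟨l, hl, h⟩ := intermediate_value_Icc' (by norm_num) hc
    ⟨parameterFun_upper_neg.le, parameterFun_lower_pos.le⟩
  refine ⟨l, ⟨⟨by linarith [hl.1], by linarith [hl.2]⟩, h⟩, fun m hm => ?_⟩
  have hm' := hm.mem_Ioo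
  refine strictAntiOn_parameterFun.injOn ⟨by linarith [hm'.1], by linarith [hm'.2]⟩
    ⟨by linarith [hl.1], by linarith [hl.2]⟩ ?_
  rw [h]
  exact hm.2

/-! ### Marginals of the layered measure. -/

/-- The density of a layered measure, extended by zero outside of `x, y, z ≤ 1`. -/
def layerKernel (p : ℝ → ℝ) (x y z : ℝ) : ENNReal :=
  {s : ℝ × ℝ × ℝ | s.1 ≤ 1 ∧ s.2.1 ≤ 1 ∧ s.2.2 ≤ 1}.indicator
    (fun s => ENNReal.ofReal (p (min (1 - s.1) (min (1 - s.2.1) (1 - s.2.2))))) (x, y, z)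

theorem measurable_layerKernel {p : ℝ → ℝ} (hp : Measurable p) :
    Measurable fun s : ℝ × ℝ × ℝ => layerKernel p s.1 s.2.1 s.2.2 := by
  unfold layerKernel
  refine Measurable.indicator (by fun_prop) ?_
  measurability

theorem layerKernel_swap (p : ℝ → ℝ) (x y z : ℝ) : layerKernel p y x z = layerKernel p x y z := by
  have h : min (1 - y) (min (1 - x) (1 - z)) = min (1 - x) (min (1 - y) (1 - z)) :=
    min_left_comm _ _ _
  simp only [layerKernel, indicator, mem_ofPred_eq, h]
  congr 1
  simp only [eq_iff_iff]
  tauto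

theorem layerKernel_swap_right (p : ℝ → ℝ) (x y z : ℝ) :
    layerKernel p x z y = layerKernel p x y z := by
  simp only [layerKernel, indicator, mem_ofPred_eq, min_comm (1 - z) (1 - y)]
  congr 1
  simp only [eq_iff_iff]
  tauto

/-- The density of the one-dimensional marginals of a layered measure. -/
def layerDensity (p : ℝ → ℝ) (u : ℝ) : ENNReal := ∫⁻ y, layerKernel p u y (2 - u - y)

theorem lintegral_layeredMeasure {p : ℝ → ℝ} (hp : Measurable p) {g : ℝ × ℝ × ℝ → ENNReal}
    (hg : Measurable g) :
    ∫⁻ P, g P ∂layeredMeasure p =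
      ∫⁻ x, ∫⁻ y, layerKernel p x y (2 - x - y) * g (x, y, 2 - x - y) := by
  have hT : MeasurableSet {s : ℝ × ℝ | s.1 ≤ 1 ∧ s.2 ≤ 1 ∧ 1 ≤ s.1 + s.2} := by
    measurability
  have hk := measurable_layerKernel hp
  have hk' : Measurable fun s : ℝ × ℝ =>
      layerKernel p s.1 s.2 (2 - s.1 - s.2) * g (s.1, s.2, 2 - s.1 - s.2) :=
    (hk.comp (g := fun s : ℝ × ℝ × ℝ => layerKernel p s.1 s.2.1 s.2.2)
      (f := fun s : ℝ × ℝ => (s.1, s.2, 2 - s.1 - s.2)) (by fun_prop)).mul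
      (hg.comp (by fun_prop))
  rw [layeredMeasure, lintegral_withDensity_eq_lintegral_mul _ (by fun_prop) hg, triangleMeasure,
    lintegral_map (by fun_prop) (by fun_prop), ← lintegral_indicator hT, Measure.volume_eq_prod,
    ← lintegral_prod _ hk'.aemeasurable]
  refine lintegral_congr fun s => ?_
  have : (2 - s.1 - s.2 ≤ 1) = (1 ≤ s.1 + s.2) := by
    rw [eq_iff_iff]
    constructor <;> intro h <;> linarith
  simp only [indicator, layerKernel, mem_ofPred_eq, Pi.mul_apply, this]
  split_ifs <;> simp

theorem lintegral_fst_layeredMeasure {p : ℝ → ℝ} (hp : Measurable p) {f : ℝ → ENNReal}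
    (hf : Measurable f) :
    ∫⁻ P, f P.1 ∂layeredMeasure p = ∫⁻ u, layerDensity p u * f u := by
  rw [lintegral_layeredMeasure hp (g := fun P => f P.1) (by fun_prop)]
  refine lintegral_congr fun x => ?_
  have hk : Measurable fun y => layerKernel p x y (2 - x - y) :=
    (measurable_layerKernel hp).comp (f := fun y : ℝ => (x, y, 2 - x - y)) (by fun_prop)
  dsimp only
  rw [lintegral_mul_const _ hk, layerDensity]

theorem lintegral_snd_layeredMeasure {p : ℝ → ℝ} (hp : Measurable p) {f : ℝ → ENNReal}
    (hf : Measurable f) :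
    ∫⁻ P, f P.2.1 ∂layeredMeasure p = ∫⁻ u, layerDensity p u * f u := by
  have hk2 : Measurable fun s : ℝ × ℝ => layerKernel p s.1 s.2 (2 - s.1 - s.2) :=
    (measurable_layerKernel hp).comp (f := fun s : ℝ × ℝ => (s.1, s.2, 2 - s.1 - s.2))
      (by fun_prop)
  rw [lintegral_layeredMeasure hp (g := fun P => f P.2.1) (by fun_prop),
    lintegral_lintegral_swap (f := fun x y => layerKernel p x y (2 - x - y) * f y)
      (hk2.mul (hf.comp measurable_snd)).aemeasurable]
  refine lintegral_congr fun y => ?_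
  have hk : Measurable fun x => layerKernel p x y (2 - x - y) :=
    (measurable_layerKernel hp).comp (f := fun x : ℝ => (x, y, 2 - x - y)) (by fun_prop)
  rw [lintegral_mul_const _ hk, layerDensity]
  simp only [layerKernel_swap p y, sub_right_comm]

/-- For fixed `x`, the reflection `y ↦ 2 - x - y` exchanges the last two coordinates, and the kernel
is symmetric in them. -/
theorem lintegral_trd_layeredMeasure {p : ℝ → ℝ} (hp : Measurable p) {f : ℝ → ENNReal}
    (hf : Measurable f) :
    ∫⁻ P, f P.2.2 ∂layeredMeasure p = ∫⁻ u, layerDensity p u * f u := by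
  have h : ∀ x, ∫⁻ y, layerKernel p x y (2 - x - y) * f (2 - x - y)
      = ∫⁻ z, layerKernel p x z (2 - x - z) * f z := fun x => by
    rw [← lintegral_sub_left_eq_self (fun z => layerKernel p x z (2 - x - z) * f z) (2 - x)]
    refine lintegral_congr fun y => ?_
    rw [layerKernel_swap_right, sub_sub_cancel]
  rw [lintegral_layeredMeasure hp (g := fun P => f P.2.2) (by fun_prop),
    ← lintegral_snd_layeredMeasure hp hf,
    lintegral_layeredMeasure hp (g := fun P => f P.2.1) (by fun_prop)]
  exact lintegral_congr h

theorem lintegral_Icc_comp_affine {a b c d : ℝ} (hc : 0 < c) (f : ℝ → ENNReal) :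
    ENNReal.ofReal c * ∫⁻ t in Icc a b, f (d - c * t) = ∫⁻ u in Icc (d - c * b) (d - c * a), f u := by
  have himg : (fun t => d - c * t) '' Icc a b = Icc (d - c * b) (d - c * a) := by
    have : (fun t => d - c * t) = (fun x => d - x) ∘ (fun t => c * t) := rfl
    rw [this, image_comp, image_mul_left_Icc' hc, image_const_sub_Icc]
  have hderiv : ∀ x ∈ Icc a b, HasDerivWithinAt (fun t => d - c * t) (-c) (Icc a b) x :=
    fun x _ => by
      simpa using (((hasDerivAt_id x).const_mul c).const_sub d).hasDerivWithinAt
  have hinj : InjOn (fun t => d - c * t) (Icc a b) := fun x _ y _ h =>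
    mul_left_cancel₀ hc.ne' (sub_right_injective h)
  rw [← himg, lintegral_image_eq_lintegral_abs_deriv_mul measurableSet_Icc hderiv hinj]
  simp only [abs_neg, abs_of_pos hc]
  rw [lintegral_const_mul' _ _ ENNReal.ofReal_ne_top]

/-- Substituting `y = 1 - b` turns the three distances `1 - x`, `1 - y`, `1 - z` into `1 - u`, `b`,
`u - b`. -/
theorem layerDensity_eq_setLIntegral {p : ℝ → ℝ} {u : ℝ} (hu : u ≤ 1) :
    layerDensity p u =
      ∫⁻ b in Icc 0 u, ENNReal.ofReal (p (min (1 - u) (min b (u - b)))) := by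
  rw [layerDensity, ← lintegral_sub_left_eq_self _ 1, ← lintegral_indicator measurableSet_Icc]
  refine lintegral_congr fun b => ?_
  have h1 : (u ≤ 1 ∧ 1 - b ≤ 1 ∧ 2 - u - (1 - b) ≤ 1) ↔ 0 ≤ b ∧ b ≤ u := by
    constructor
    · rintro ⟨-, h, h'⟩
      constructor <;> linarith
    · rintro ⟨h, h'⟩
      refine ⟨hu, ?_, ?_⟩ <;> linarith
  have h2 : 1 - (2 - u - (1 - b)) = u - b := by ring
  simp only [layerKernel, indicator, mem_ofPred_eq, mem_Icc, h1, h2, sub_sub_cancel]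

theorem layerDensity_eq_zero {p : ℝ → ℝ} {u : ℝ} (hu : u ∉ Icc (0 : ℝ) 1) :
    layerDensity p u = 0 := by
  rw [layerDensity, lintegral_eq_zero_of_ae_eq_zero]
  refine Filter.Eventually.of_forall fun y => ?_
  refine indicator_of_notMem ?_ _
  rintro ⟨h1, h2, h3⟩
  dsimp only at h1 h2 h3
  exact hu ⟨by linarith, h1⟩

theorem continuousOn_layerGen {α : ℝ} (hα : 1 < α) : ContinuousOn (layerGen α) (Iio (1 / 3)) := by
  have ha := (Real.log_pos hα).ne'
  have h0 : α ≠ 0 := by linarith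
  have hA : ContinuousOn (fun x : ℝ => α ^ (2 * x)) (Iio (1 / 3)) :=
    ((Real.continuous_const_rpow h0).comp (by fun_prop)).continuousOn
  have hB : ContinuousOn (fun x : ℝ => α ^ (1 - x)) (Iio (1 / 3)) :=
    ((Real.continuous_const_rpow h0).comp (by fun_prop)).continuousOn
  have hy : ∀ x ∈ Iio (1 / 3 : ℝ), 1 - 3 * x ≠ 0 := fun x (hx : x < 1 / 3) => by linarith
  unfold layerGen
  fun_prop (disch := intro x hx; have := hy x hx; positivity)

theorem measurable_layerGen (α : ℝ) : Measurable (layerGen α) := by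
  unfold layerGen
  fun_prop

theorem measurable_medianGen (α : ℝ) : Measurable (medianGen α) := by
  unfold medianGen medianGenTwice
  fun_prop

theorem integral_layerGen {α m : ℝ} (hα : 1 < α) (hP : layerPrimitive α 0 = 0) (h0 : 0 ≤ m)
    (hm : m < 1 / 3) : ∫ b in 0..m, layerGen α b = layerPrimitive α m := by
  rw [intervalIntegral.integral_eq_sub_of_hasDerivAt (f := layerPrimitive α), hP, sub_zero]
  · intro x hx
    rw [uIcc_of_le h0] at hx
    exact hasDerivAt_layerPrimitive hα (by linarith [hx.2])
  · refine ((continuousOn_layerGen hα).mono fun x hx => ?_).intervalIntegrable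
    rw [uIcc_of_le h0] at hx
    exact lt_of_le_of_lt hx.2 hm

/-- As `b` runs over `[0, u]`, the distance `min (1 - u) (min b (u - b))` rises with slope 1 to its
maximum `m`, stays there on `[m, u - m]`, and falls back to 0. The value `u = 2/3` is excluded
because there `m = 1/3`, where the formula for `p` has zero denominators. -/
theorem layerDensity_layerGen {α u : ℝ} (hα : 1 < α) (hP : layerPrimitive α 0 = 0)
    (hu : u ∈ Icc (0 : ℝ) 1) (hu' : u ≠ 2 / 3) {m : ℝ} (hm : m = min (1 - u) (u / 2)) :
    layerDensity (layerGen α) u =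
      ENNReal.ofReal (2 * layerPrimitive α m + (u - 2 * m) * layerGen α m) := by
  obtain ⟨hu0, hu1⟩ := hu
  have hm1 : m ≤ 1 - u := hm ▸ min_le_left _ _
  have hm2 : m ≤ u / 2 := hm ▸ min_le_right _ _
  have hm0 : 0 ≤ m := hm ▸ le_min (by linarith) (by linarith)
  have hm3 : m < 1 / 3 := by
    rcases lt_or_gt_of_ne hu' with h | h <;> linarith
  have hmin : ∀ b, min (1 - u) (min b (u - b)) ≤ m := fun b => by
    rw [hm]
    refine le_min (min_le_left _ _) ((min_le_right _ _).trans ?_)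
    rcases le_total b (u / 2) with h | h
    · exact (min_le_left _ _).trans h
    · exact (min_le_right _ _).trans (by linarith)
  have hc : Continuous fun b => layerGen α (min (1 - u) (min b (u - b))) :=
    (continuousOn_layerGen hα).comp_continuous (by fun_prop) fun b => (hmin b).trans_lt hm3
  rw [layerDensity_eq_setLIntegral hu1, ← ofReal_integral_eq_lintegral_ofReal
    (hc.continuousOn.integrableOn_compact isCompact_Icc)
    (Filter.Eventually.of_forall fun b => layerGen_nonneg hα ((hmin b).trans_lt hm3)),
    integral_Icc_eq_integral_Ioc, ← intervalIntegral.integral_of_le hu0,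
    ← intervalIntegral.integral_add_adjacent_intervals (b := u - m)
      (hc.intervalIntegrable _ _) (hc.intervalIntegrable _ _),
    ← intervalIntegral.integral_add_adjacent_intervals (b := m)
      (hc.intervalIntegrable _ _) (hc.intervalIntegrable _ _)]
  have i1 : ∫ b in 0..m, layerGen α (min (1 - u) (min b (u - b))) = layerPrimitive α m := by
    rw [← integral_layerGen hα hP hm0 hm3]
    refine intervalIntegral.integral_congr fun b hb => ?_
    rw [uIcc_of_le hm0] at hb
    rw [min_eq_left (a := b) (by linarith [hb.2]), min_eq_right (by linarith [hb.2])]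
  have i2 : ∫ b in m..u - m, layerGen α (min (1 - u) (min b (u - b)))
      = (u - 2 * m) * layerGen α m := by
    rw [show u - 2 * m = u - m - m by ring, ← smul_eq_mul, ← intervalIntegral.integral_const]
    refine intervalIntegral.integral_congr fun b hb => ?_
    rw [uIcc_of_le (by linarith)] at hb
    rw [le_antisymm (hmin b) (le_min hm1 (le_min hb.1 (by linarith [hb.2])))]
  have i3 : ∫ b in u - m..u, layerGen α (min (1 - u) (min b (u - b))) = layerPrimitive α m := by
    rw [← integral_layerGen hα hP hm0 hm3]
    have := intervalIntegral.integral_comp_sub_left (a := u - m) (b := u) (layerGen α) u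
    rw [sub_self, sub_sub_cancel] at this
    rw [← this]
    refine intervalIntegral.integral_congr fun b hb => ?_
    rw [uIcc_of_le (by linarith)] at hb
    rw [min_eq_right (a := b) (by linarith [hb.1]), min_eq_right (by linarith [hb.1])]
  rw [i1, i2, i3]
  congr 1
  ring

/-! ### Marginals of the median measure, and the combined density. -/

/-- The integral of `f` against a one-dimensional marginal of the median measure. -/
def medianMarginalIntegral (q : ℝ → ℝ) (f : ℝ → ENNReal) : ENNReal :=
  (∫⁻ u in Icc 0 (2 / 3), ENNReal.ofReal (q u) * f u) +
    4 * ∫⁻ u in Icc (2 / 3) 1, ENNReal.ofReal (q (2 * (1 - u))) * f u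

/-- On two of the three medians the coordinate is `u = 1 - t / 2`, so `dt` becomes `2 du` on each;
this is the source of the factor 4. -/
theorem medianMarginalIntegral_eq (q : ℝ → ℝ) (f : ℝ → ENNReal) :
    medianMarginalIntegral q f =
      (∫⁻ t in Icc 0 (2 / 3), ENNReal.ofReal (q t) * f t) +
        ((∫⁻ t in Icc 0 (2 / 3), ENNReal.ofReal (q t) * f (1 - t / 2)) +
          ∫⁻ t in Icc 0 (2 / 3), ENNReal.ofReal (q t) * f (1 - t / 2)) := by
  have h := lintegral_Icc_comp_affine (a := 0) (b := 2 / 3) (c := 1 / 2) (d := 1) (by norm_num)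
    fun u => ENNReal.ofReal (q (2 * (1 - u))) * f u
  have h1 : ∀ t : ℝ, 2 * (1 - (1 - t / 2)) = t := fun t => by ring
  have h2 : ∀ t : ℝ, 1 - 1 / 2 * t = 1 - t / 2 := fun t => by ring
  have h3 : (4 : ENNReal) * ENNReal.ofReal (1 / 2) = 2 := by
    rw [show (4 : ENNReal) = ENNReal.ofReal 4 by simp, ← ENNReal.ofReal_mul (by norm_num)]
    norm_num
  simp only [h2, h1] at h
  norm_num only at h
  rw [medianMarginalIntegral, ← two_mul, ← h3, mul_assoc, ← h]

theorem lintegral_medianMeasure {q : ℝ → ℝ} (hq : Measurable q) {g : ℝ × ℝ × ℝ → ENNReal}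
    (hg : Measurable g) :
    ∫⁻ P, g P ∂medianMeasure q =
      (∫⁻ t in Icc 0 (2 / 3), ENNReal.ofReal (q t) * g (1 - t / 2, 1 - t / 2, t)) +
      (∫⁻ t in Icc 0 (2 / 3), ENNReal.ofReal (q t) * g (1 - t / 2, t, 1 - t / 2)) +
      ∫⁻ t in Icc 0 (2 / 3), ENNReal.ofReal (q t) * g (t, 1 - t / 2, 1 - t / 2) := by
  simp only [medianMeasure, lintegral_add_measure]
  rw [lintegral_map hg (by fun_prop), lintegral_map hg (by fun_prop),
    lintegral_map hg (by fun_prop),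
    lintegral_withDensity_eq_lintegral_mul _ (by fun_prop) (by fun_prop),
    lintegral_withDensity_eq_lintegral_mul _ (by fun_prop) (by fun_prop),
    lintegral_withDensity_eq_lintegral_mul _ (by fun_prop) (by fun_prop)]
  rfl

theorem layerDensity_add_medianMarginalIntegral {α : ℝ} (hα : 1 < α)
    (hP : layerPrimitive α 0 = 0) {f : ℝ → ENNReal} (hf : Measurable f) :
    (∫⁻ u, layerDensity (layerGen α) u * f u) + medianMarginalIntegral (medianGen α) f =
      ∫⁻ u in Icc 0 1, ENNReal.ofReal (α ^ u) * f u := by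
  have hq := measurable_medianGen α
  rw [medianMarginalIntegral, ← lintegral_const_mul _ (by fun_prop),
    ← lintegral_indicator measurableSet_Icc, ← lintegral_indicator measurableSet_Icc,
    ← lintegral_indicator measurableSet_Icc,
    ← lintegral_add_right _ (Measurable.indicator (by fun_prop) measurableSet_Icc),
    ← lintegral_add_right _ ((Measurable.indicator (by fun_prop) measurableSet_Icc).fun_add
      (Measurable.indicator (by fun_prop) measurableSet_Icc))]
  have hae : ∀ᵐ u : ℝ, u ≠ 2 / 3 := by simp [ae_iff]
  refine lintegral_congr_ae (hae.mono fun u hu => ?_)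
  dsimp only
  by_cases hu01 : u ∈ Icc (0 : ℝ) 1
  · rw [indicator_of_mem hu01, layerDensity_layerGen hα hP hu01 hu rfl]
    rcases lt_or_gt_of_ne hu with h | h
    · have hm : min (1 - u) (u / 2) = u / 2 := min_eq_right (by linarith)
      rw [indicator_of_mem (show u ∈ Icc 0 (2 / 3) from ⟨hu01.1, h.le⟩), indicator_of_notMem (fun h' => by linarith [h'.1]),
        add_zero, ← add_mul, hm, sub_eq_zero.2 (by ring : u = 2 * (u / 2)), zero_mul, add_zero,
        medianGen, ← ENNReal.ofReal_add _ (medianGenTwice_nonneg hα (by linarith))]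
      · rw [layerPrimitive, show 2 * (u / 2) = u by ring]
        congr 2
        ring
      -- Adding the `ENNReal.ofReal` terms needs `0 ≤ P`, visible only from the integral form of
      -- `P`, hence from `P 0 = 0`.
      · rw [← integral_layerGen hα hP (by linarith [hu01.1]) (by linarith)]
        refine mul_nonneg (by norm_num) (intervalIntegral.integral_nonneg (by linarith [hu01.1])
          fun x hx => layerGen_nonneg hα (by linarith [hx.2]))
    · have hm : min (1 - u) (u / 2) = 1 - u := min_eq_left (by linarith)
      have hq4 : ENNReal.ofReal (4 * medianGenTwice α (1 - u))
          = 4 * ENNReal.ofReal (medianGenTwice α (1 - u)) := by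
        rw [ENNReal.ofReal_mul (by norm_num)]
        simp
      have hx : 1 - u < 1 / 3 := by linarith
      have hrel := layerGen_relation hα hx
      rw [indicator_of_notMem (fun h' => by linarith [h'.2]),
        indicator_of_mem (show u ∈ Icc (2 / 3) 1 from ⟨h.le, hu01.2⟩),
        zero_add, ← mul_assoc, ← add_mul, hm, medianGen, show 2 * (1 - u) / 2 = 1 - u by ring,
        ← hq4, ← ENNReal.ofReal_add _
          (mul_nonneg (by norm_num) (medianGenTwice_nonneg hα hx))]
      · rw [sub_sub_cancel] at hrel
        rw [← hrel]
        congr 2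
        ring
      · rw [← integral_layerGen hα hP (by linarith [hu01.2]) hx]
        refine add_nonneg (mul_nonneg (by norm_num)
          (intervalIntegral.integral_nonneg (by linarith [hu01.2])
            fun x hx => layerGen_nonneg hα (by linarith [hx.2])))
          (mul_nonneg (by linarith) (layerGen_nonneg hα hx))
  · rw [indicator_of_notMem hu01, layerDensity_eq_zero hu01,
      indicator_of_notMem (fun h => hu01 ⟨h.1, by linarith [h.2]⟩),
      indicator_of_notMem (fun h => hu01 ⟨by linarith [h.1], h.2⟩)]
    simp

/-! ### Change of variables to the surface, and marginals of the explicit measure. -/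

theorem lintegral_Icc_comp_exp {l α : ℝ} (hl : 0 < l) (hα : 1 < α) (f : ℝ → ENNReal) :
    ENNReal.ofReal (l * Real.log α) *
        ∫⁻ u in Icc (0 : ℝ) 1, ENNReal.ofReal (α ^ u) * f (l * α ^ u) =
      ∫⁻ x in Icc l (l * α), f x := by
  have h0 : 0 < α := by linarith
  have ha := Real.log_pos hα
  have hmono : StrictMono fun u : ℝ => l * α ^ u :=
    (Real.strictMono_rpow_of_base_gt_one hα).const_mul hl
  have himg : (fun u : ℝ => l * α ^ u) '' Icc 0 1 = Icc l (l * α) := by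
    have hc : Continuous fun u : ℝ => l * α ^ u :=
      continuous_const.mul (Real.continuous_const_rpow h0.ne')
    refine subset_antisymm ?_ ?_
    · have := hmono.monotone.image_Icc_subset (a := 0) (b := 1)
      simpa using this
    · have := intermediate_value_Icc (zero_le_one (α := ℝ)) hc.continuousOn
      simpa using this
  have hderiv : ∀ u ∈ Icc (0 : ℝ) 1, HasDerivWithinAt (fun u : ℝ => l * α ^ u)
      (l * (Real.log α * 1 * α ^ u)) (Icc 0 1) u := fun u _ =>
    (((hasDerivAt_id u).const_rpow h0).const_mul l).hasDerivWithinAt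
  rw [← himg, lintegral_image_eq_lintegral_abs_deriv_mul measurableSet_Icc hderiv
    hmono.injective.injOn, ← lintegral_const_mul' _ _ ENNReal.ofReal_ne_top]
  refine lintegral_congr fun u => ?_
  have hu : 0 < α ^ u := Real.rpow_pos_of_pos h0 u
  rw [abs_of_pos (by positivity), ← mul_assoc, ← ENNReal.ofReal_mul (by positivity)]
  congr 2
  ring

theorem lintegral_segmentMeasure {l : ℝ} {g : ℝ × ℝ × ℝ → ENNReal} (hg : Measurable g) :
    ∫⁻ P, g P ∂segmentMeasure l =
      (∫⁻ t in Icc 0 l, g (t, 1 - 2 * t, 1 - 2 * t)) +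
      (∫⁻ t in Icc 0 l, g (1 - 2 * t, t, 1 - 2 * t)) +
      ∫⁻ t in Icc 0 l, g (1 - 2 * t, 1 - 2 * t, t) := by
  simp only [segmentMeasure, lintegral_add_measure]
  rw [lintegral_map hg (by fun_prop), lintegral_map hg (by fun_prop),
    lintegral_map hg (by fun_prop)]

/-- Treats the three coordinates at once: the hypotheses on `c` record that each coordinate sees the
three pieces in the same way. -/
theorem map_explicitMeasure {l : ℝ} (hl : IsParameter l) {c : ℝ × ℝ × ℝ → ℝ} (hc : Measurable c)
    (hlayer : ∀ (p : ℝ → ℝ) (f : ℝ → ENNReal), Measurable p → Measurable f →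
      ∫⁻ P, f (c P) ∂layeredMeasure p = ∫⁻ u, layerDensity p u * f u)
    (hmedian : ∀ (q : ℝ → ℝ) (f : ℝ → ENNReal), Measurable q → Measurable f →
      ∫⁻ P, f (c P) ∂medianMeasure q = medianMarginalIntegral q f)
    (hsegment : ∀ f : ℝ → ENNReal, Measurable f → ∫⁻ P, f (c P) ∂segmentMeasure l =
      (∫⁻ t in Icc 0 l, f t) + 2 * ∫⁻ t in Icc 0 l, f (1 - 2 * t))
    (hexp : ∀ α P, c (expMap l α P) = l * α ^ c P) :
    (explicitMeasure l).map c = volume.restrict (Icc 0 1) := by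
  obtain ⟨hα, hlog⟩ := log_ratio_of_isParameter hl
  have hl0 : 0 < l := hl.1.1
  have hl4 : l < 1 / 4 := hl.1.2
  have hr : l * ((1 - 2 * l) / l) = 1 - 2 * l := mul_div_cancel₀ _ hl0.ne'
  refine Measure.ext_of_lintegral _ fun f hf => ?_
  have hm : Measurable (expMap l ((1 - 2 * l) / l)) := by
    unfold expMap
    fun_prop
  have hfe : Measurable fun u : ℝ => f (l * ((1 - 2 * l) / l) ^ u) := by fun_prop
  have h2 : ENNReal.ofReal 2 = 2 := by simp
  have haff := lintegral_Icc_comp_affine (a := 0) (b := l) (c := 2) (d := 1) two_pos f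
  rw [h2, mul_zero, sub_zero] at haff
  simp only [explicitMeasure]
  rw [lintegral_map hf hc, lintegral_add_measure, lintegral_smul_measure,
    lintegral_map (f := fun P => f (c P)) (hf.comp hc) hm, hsegment f hf, haff, smul_eq_mul, lintegral_add_measure]
  simp only [hexp]
  rw [hlayer _ _ (measurable_layerGen _) hfe, hmedian _ _ (measurable_medianGen _) hfe,
    layerDensity_add_medianMarginalIntegral hα (layerPrimitive_zero hα hlog) hfe,
    -- The three pieces live on `[0, l]`, `[l, r]`, `[r, 1]`; dropping a null endpoint makes them
    -- disjoint, so that they glue to `[0, 1]`.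
    lintegral_Icc_comp_exp hl0 hα f, hr, setLIntegral_congr (Ico_ae_eq_Icc (a := 0) (b := l)).symm,
    setLIntegral_congr (Ico_ae_eq_Icc (a := l)).symm, add_right_comm,
    ← lintegral_union measurableSet_Ico Ico_disjoint_Ico_same,
    Ico_union_Ico_eq_Ico hl0.le (by linarith),
    ← lintegral_union measurableSet_Icc
      (disjoint_left.2 fun x hx hx' => absurd hx.2 (not_lt.2 hx'.1)),
    Ico_union_Icc_eq_Icc (by linarith) (by linarith)]

theorem map_fst_explicitMeasure {l : ℝ} (hl : IsParameter l) :
    (explicitMeasure l).map (fun P => P.1) = volume.restrict (Icc 0 1) := by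
  refine map_explicitMeasure hl measurable_fst (fun p f hp hf => lintegral_fst_layeredMeasure hp hf)
    (fun q f hq hf => ?_) (fun f hf => ?_) fun α P => rfl
  · rw [lintegral_medianMeasure hq (g := fun P => f P.1) (by fun_prop), medianMarginalIntegral_eq,
      add_comm]
  · rw [lintegral_segmentMeasure (g := fun P => f P.1) (by fun_prop), two_mul, add_assoc]

theorem map_snd_explicitMeasure {l : ℝ} (hl : IsParameter l) :
    (explicitMeasure l).map (fun P => P.2.1) = volume.restrict (Icc 0 1) := by
  refine map_explicitMeasure hl (by fun_prop) (fun p f hp hf => lintegral_snd_layeredMeasure hp hf)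
    (fun q f hq hf => ?_) (fun f hf => ?_) fun α P => rfl
  · rw [lintegral_medianMeasure hq (g := fun P => f P.2.1) (by fun_prop),
      medianMarginalIntegral_eq]
    ring
  · rw [lintegral_segmentMeasure (g := fun P => f P.2.1) (by fun_prop)]
    ring

theorem map_trd_explicitMeasure {l : ℝ} (hl : IsParameter l) :
    (explicitMeasure l).map (fun P => P.2.2) = volume.restrict (Icc 0 1) := by
  refine map_explicitMeasure hl (by fun_prop) (fun p f hp hf => lintegral_trd_layeredMeasure hp hf)
    (fun q f hq hf => ?_) (fun f hf => ?_) fun α P => rfl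
  · rw [lintegral_medianMeasure hq (g := fun P => f P.2.2) (by fun_prop),
      medianMarginalIntegral_eq]
    ring
  · rw [lintegral_segmentMeasure (g := fun P => f P.2.2) (by fun_prop)]
    ring

/-! ### Concentration on `M`, and the total mass. -/

theorem measurableSet_setM (l : ℝ) : MeasurableSet (setM l) := by
  have hseg : ∀ φ : ℝ → ℝ × ℝ × ℝ, Continuous φ → MeasurableSet {P | ∃ t ∈ Icc 0 l, P = φ t} :=
    fun φ hφ => by
      have : {P | ∃ t ∈ Icc 0 l, P = φ t} = φ '' Icc 0 l := by
        ext P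
        simp only [mem_ofPred_eq, mem_image, eq_comm]
      rw [this]
      exact (isCompact_Icc.image hφ).measurableSet
  refine (((hseg _ (by fun_prop)).union (hseg _ (by fun_prop))).union
    (hseg _ (by fun_prop))).union ?_
  unfold surf
  measurability

/-- The triangle `u + v + w = 2`, `0 ≤ u, v, w ≤ 1`. -/
def triangle : Set (ℝ × ℝ × ℝ) :=
  {P | P.1 ∈ Icc (0 : ℝ) 1 ∧ P.2.1 ∈ Icc (0 : ℝ) 1 ∧ P.2.2 ∈ Icc (0 : ℝ) 1 ∧
    P.1 + P.2.1 + P.2.2 = 2}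

theorem measurableSet_triangle : MeasurableSet triangle := by
  unfold triangle
  measurability

theorem layeredMeasure_compl_triangle {p : ℝ → ℝ} (hp : Measurable p) :
    layeredMeasure p triangleᶜ = 0 := by
  have hm := measurableSet_triangle.compl
  rw [← lintegral_indicator_one hm, lintegral_layeredMeasure hp (measurable_one.indicator hm)]
  have h0 : ∀ x y, layerKernel p x y (2 - x - y) *
      triangleᶜ.indicator (1 : ℝ × ℝ × ℝ → ENNReal) (x, y, 2 - x - y) = 0 := fun x y => by
    rw [mul_eq_zero, layerKernel, indicator_apply_eq_zero, indicator_apply_eq_zero]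
    by_cases h : x ≤ 1 ∧ y ≤ 1 ∧ 2 - x - y ≤ 1
    -- The lower bounds come for free: if two coordinates are at most 1 and the sum is 2, the third
    -- is nonnegative.
    · right
      intro h'
      refine absurd ⟨⟨?_, ?_⟩, ⟨?_, ?_⟩, ⟨?_, ?_⟩, ?_⟩ h'
      all_goals
        dsimp only
        linarith [h.1, h.2.1, h.2.2]
    · left
      intro h'
      exact absurd h' h
  simp only [h0, lintegral_zero]

theorem medianMeasure_compl_triangle {q : ℝ → ℝ} (hq : Measurable q) :
    medianMeasure q triangleᶜ = 0 := by
  have hm := measurableSet_triangle.compl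
  have key : ∀ φ : ℝ → ℝ × ℝ × ℝ, (∀ t ∈ Icc (0 : ℝ) (2 / 3), φ t ∈ triangle) →
      ∫⁻ t in Icc 0 (2 / 3), ENNReal.ofReal (q t) * triangleᶜ.indicator 1 (φ t) = 0 :=
    fun φ hφ => by
      rw [setLIntegral_congr_fun (g := fun _ => 0) measurableSet_Icc, lintegral_zero]
      intro t ht
      dsimp only
      rw [indicator_of_notMem (notMem_compl_iff.2 (hφ t ht)), mul_zero]
  rw [← lintegral_indicator_one hm, lintegral_medianMeasure hq (measurable_one.indicator hm),
    key (fun t => (1 - t / 2, 1 - t / 2, t)), key (fun t => (1 - t / 2, t, 1 - t / 2)),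
    key (fun t => (t, 1 - t / 2, 1 - t / 2)), add_zero, add_zero]
  all_goals
    intro t ht
    refine ⟨⟨?_, ?_⟩, ⟨?_, ?_⟩, ⟨?_, ?_⟩, ?_⟩
    all_goals
      dsimp only
      linarith [ht.1, ht.2]

theorem expMap_mem_surf {l : ℝ} (hl0 : 0 < l) (hα : 1 < (1 - 2 * l) / l) {P : ℝ × ℝ × ℝ}
    (hP : P ∈ triangle) : expMap l ((1 - 2 * l) / l) P ∈ surf l := by
  obtain ⟨h1, h2, h3, h4⟩ := hP
  have hr : l * ((1 - 2 * l) / l) = 1 - 2 * l := mul_div_cancel₀ _ hl0.ne'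
  have key : ∀ u ∈ Icc (0 : ℝ) 1, l * ((1 - 2 * l) / l) ^ u ∈ Icc l (1 - 2 * l) := fun u hu => by
    have ha := Real.one_le_rpow hα.le hu.1
    have hb := Real.rpow_le_rpow_of_exponent_le hα.le hu.2
    rw [Real.rpow_one] at hb
    exact ⟨le_mul_of_one_le_right hl0.le ha, (mul_le_mul_of_nonneg_left hb hl0.le).trans_eq hr⟩
  refine ⟨key _ h1, key _ h2, key _ h3, ?_⟩
  have h5 : ((1 - 2 * l) / l) ^ P.1 * ((1 - 2 * l) / l) ^ P.2.1 * ((1 - 2 * l) / l) ^ P.2.2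
      = ((1 - 2 * l) / l) ^ 2 := by
    rw [← Real.rpow_add (by linarith), ← Real.rpow_add (by linarith), h4, Real.rpow_two]
  simp only [expMap]
  calc _ = l ^ 3 * (((1 - 2 * l) / l) ^ P.1 * ((1 - 2 * l) / l) ^ P.2.1 *
        ((1 - 2 * l) / l) ^ P.2.2) := by ring
    _ = _ := by
      rw [h5]
      field_simp

theorem explicitMeasure_compl_setM {l : ℝ} (hl : IsParameter l) :
    explicitMeasure l (setM l)ᶜ = 0 := by
  have hα := (log_ratio_of_isParameter hl).1
  have hM := (measurableSet_setM l).compl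
  have hm : Measurable (expMap l ((1 - 2 * l) / l)) := by
    unfold expMap
    fun_prop
  have hsub : expMap l ((1 - 2 * l) / l) ⁻¹' (setM l)ᶜ ⊆ triangleᶜ := fun P hP hP' =>
    hP (Or.inr (expMap_mem_surf hl.1.1 hα hP'))
  have hseg : segmentMeasure l (setM l)ᶜ = 0 := by
    have key : ∀ φ : ℝ → ℝ × ℝ × ℝ, Measurable φ → (∀ t ∈ Icc 0 l, φ t ∈ setM l) →
        (volume.restrict (Icc 0 l)).map φ (setM l)ᶜ = 0 := fun φ hφ h => by
      rw [Measure.map_apply hφ hM, Measure.restrict_apply (hφ hM)]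
      convert measure_empty (μ := (volume : Measure ℝ))
      exact eq_empty_of_forall_notMem fun t ht => ht.1 (h t ht.2)
    simp only [segmentMeasure, Measure.add_apply]
    rw [key _ (by fun_prop) fun t ht => Or.inl (Or.inl (Or.inl ⟨t, ht, rfl⟩)),
      key _ (by fun_prop) fun t ht => Or.inl (Or.inl (Or.inr ⟨t, ht, rfl⟩)),
      key _ (by fun_prop) fun t ht => Or.inl (Or.inr ⟨t, ht, rfl⟩), add_zero, add_zero]
  simp only [explicitMeasure]
  rw [Measure.add_apply, hseg, Measure.smul_apply, Measure.map_apply hm hM, Measure.add_apply,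
    measure_mono_null hsub (layeredMeasure_compl_triangle (measurable_layerGen _)),
    measure_mono_null hsub (medianMeasure_compl_triangle (measurable_medianGen _))]
  simp

theorem setM_subset_Icc {l : ℝ} (hl0 : 0 < l) (hl4 : l < 1 / 4) :
    setM l ⊆ Icc (0, 0, 0) (1, 1, 1) := by
  rintro P (((⟨t, ht, rfl⟩ | ⟨t, ht, rfl⟩) | ⟨t, ht, rfl⟩) | ⟨h1, h2, h3, -⟩)
  on_goal 4 =>
    refine ⟨⟨?_, ?_, ?_⟩, ?_, ?_, ?_⟩
    all_goals
      dsimp only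
      linarith [h1.1, h1.2, h2.1, h2.2, h3.1, h3.2]
  all_goals
    refine ⟨⟨?_, ?_, ?_⟩, ?_, ?_, ?_⟩
    all_goals
      dsimp only
      linarith [ht.1, ht.2]

theorem isThreeOneStochastic_explicitMeasure {l : ℝ} (hl : IsParameter l) :
    IsThreeOneStochastic (explicitMeasure l) := by
  refine ⟨⟨?_⟩, measure_mono_null (compl_subset_compl.2 (setM_subset_Icc hl.1.1 hl.1.2))
    (explicitMeasure_compl_setM hl), map_fst_explicitMeasure hl, map_snd_explicitMeasure hl,
    map_trd_explicitMeasure hl⟩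
  -- The total mass is that of the first marginal, Lebesgue measure on `[0, 1]`.
  rw [← preimage_univ (f := fun P : ℝ × ℝ × ℝ => P.1),
    ← Measure.map_apply measurable_fst MeasurableSet.univ, map_fst_explicitMeasure hl]
  simp

end

theorem mainTheorem2 :
    (∃! l : ℝ, IsParameter l) ∧
    ∀ l : ℝ, IsParameter l →
      |l - 0.0945| < 0.00005 ∧
      (∀ x ∈ Set.Ico (0 : ℝ) (1 / 3), 0 ≤ layerGen ((1 - 2 * l) / l) x) ∧
      (∀ t ∈ Set.Ico (0 : ℝ) (2 / 3), 0 ≤ medianGen ((1 - 2 * l) / l) t) ∧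
      ∃ μ : MeasureTheory.Measure (ℝ × ℝ × ℝ),
        IsThreeOneStochastic μ ∧ μ (setM l)ᶜ = 0 ∧ μ = explicitMeasure l := by
  refine ⟨existsUnique_isParameter, fun l hl => ?_⟩
  have hα := (log_ratio_of_isParameter hl).1
  refine ⟨?_, fun x hx => layerGen_nonneg hα hx.2,
    fun t ht => medianGenTwice_nonneg hα (by linarith [ht.2]), explicitMeasure l,
    isThreeOneStochastic_explicitMeasure hl, explicitMeasure_compl_setM hl, rfl⟩
  have h := hl.mem_Ioo
  rw [abs_lt]
  constructor <;> linarith [h.1, h.2]
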